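/- Let $S=\mathbb{C}[x,y,z]$ and, for $n\ge 0$, let $S_n$ be the vector space of homogeneous polynomials of degree $n$ (including $0$). Say that a property holds for a general element of a finite-dimensional complex vector space $V$ if it holds on a nonempty Zariski open subset of $V$. Let $d>0$ be an integer. 1. There exist $F_1,F_2,G_1,G_2\in S_d$ such that the ideal $(F_1,F_2,G_1,G_2)\subset S$ contains $S_{2d}$. The set of all quadruples $(F_1,F_2,G_1,G_2)\in S_d^4$ with this property is Zariski open in $S_d^4$; so the property holds for a general quadruple in $S_d^4$. 2. For $F_1,F_2,G_1,G_2\in S_d$ put $A=S/(F_1,F_2,G_2)$ with its induced grading $A=\bigoplus_n A_n$. Then $S_{2d}\subset(F_1,F_2,G_1,G_2)$ if and only if the multiplication map $A_d\to A_{2d}$, $a\mapsto \overline{G_1}\,a$, is surjective. In particular, this map is surjective for a general quadruple $(F_1,F_2,G_1,G_2)\in S_d^4$. 3. A general form $F\in S_{2d}$ can be written as $F=F_1G_1+F_2G_2$ with $F_1,F_2,G_1,G_2\in S_d$. -/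

import Mathlib

open MvPolynomial

/-- The space of ternary forms of degree `n`: homogeneous polynomials of degree `n` in
`ℂ[x, y, z]`, together with zero. -/
abbrev TernaryForm (n : ℕ) : Submodule ℂ (MvPolynomial (Fin 3) ℂ) :=
  homogeneousSubmodule (Fin 3) ℂ n

/-- A subset of a complex vector space `V` is Zariski open if it is the set of points where at
least one member of some family of polynomial functions on `V` does not vanish. A polynomial
function on `V` is a polynomial expression in linear functionals on `V`. -/
def IsZariskiOpen {V : Type*} [AddCommGroup V] [Module ℂ V] (U : Set V) : Prop :=
  ∃ P : Set (MvPolynomial (Module.Dual ℂ V) ℂ),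
    U = {v | ∃ p ∈ P, eval (fun φ : Module.Dual ℂ V => φ v) p ≠ 0}

/-- A property holds for a general (generic) point of `V` if it holds at all points of some
nonempty Zariski open subset of `V`. -/
def HoldsGenerically {V : Type*} [AddCommGroup V] [Module ℂ V] (p : V → Prop) : Prop :=
  ∃ U : Set V, IsZariskiOpen U ∧ U.Nonempty ∧ ∀ v ∈ U, p v

/-- Every form of degree `n` lies in the ideal `I`. -/
def ContainsAllForms (I : Ideal (MvPolynomial (Fin 3) ℂ)) (n : ℕ) : Prop :=
  ∀ Q ∈ TernaryForm n, Q ∈ I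

/-- The degree `n` piece `A_n` of `A = ℂ[x, y, z] / I`: the classes of the forms of degree `n`. -/
noncomputable def quotientPiece (I : Ideal (MvPolynomial (Fin 3) ℂ)) (n : ℕ) :
    Submodule ℂ (MvPolynomial (Fin 3) ℂ ⧸ I) :=
  (TernaryForm n).map (Ideal.Quotient.mkₐ ℂ I).toLinearMap

theorem mul_mem_quotientPiece (I : Ideal (MvPolynomial (Fin 3) ℂ)) {d : ℕ} (G : TernaryForm d)
    (a : quotientPiece I d) :
    Ideal.Quotient.mk I (G : MvPolynomial (Fin 3) ℂ) * (a : MvPolynomial (Fin 3) ℂ ⧸ I) ∈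
      quotientPiece I (2 * d) := by
  obtain ⟨a, p, hp, rfl⟩ := a
  refine ⟨G * p, ?_, by simp⟩
  rw [two_mul]
  exact IsHomogeneous.mul G.2 hp

/-- Multiplication by the class of a form `G` of degree `d`, as a map `A_d → A_{2d}`, where
`A = ℂ[x, y, z] / I`. -/
noncomputable def quotientMul (I : Ideal (MvPolynomial (Fin 3) ℂ)) {d : ℕ} (G : TernaryForm d) :
    quotientPiece I d →ₗ[ℂ] quotientPiece I (2 * d) :=
  LinearMap.codRestrict _
    ((LinearMap.mulLeft ℂ (Ideal.Quotient.mk I (G : MvPolynomial (Fin 3) ℂ))).comp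
      (quotientPiece I d).subtype)
    (mul_mem_quotientPiece I G)

/-- The ideal of `ℂ[x, y, z]` generated by four forms `F₁, F₂, G₁, G₂` of degree `d`. -/
noncomputable def idealOfFour {d : ℕ} (F₁ F₂ G₁ G₂ : TernaryForm d) : Ideal (MvPolynomial (Fin 3) ℂ) :=
  Ideal.span {(F₁ : MvPolynomial (Fin 3) ℂ), (F₂ : MvPolynomial (Fin 3) ℂ),
    (G₁ : MvPolynomial (Fin 3) ℂ), (G₂ : MvPolynomial (Fin 3) ℂ)}

/-- The ideal of `ℂ[x, y, z]` generated by three forms `F₁, F₂, G₂` of degree `d`. -/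
noncomputable def idealOfThree {d : ℕ} (F₁ F₂ G₂ : TernaryForm d) : Ideal (MvPolynomial (Fin 3) ℂ) :=
  Ideal.span {(F₁ : MvPolynomial (Fin 3) ℂ), (F₂ : MvPolynomial (Fin 3) ℂ),
    (G₂ : MvPolynomial (Fin 3) ℂ)}

/-! The witness is `(x^d, y^d, z^d, (x+y+z)^d)`. Modulo this ideal, `(x a₁a₂ + y a₀a₂ + z
a₀a₁)^(2d)` equals `(a₀a₁a₂)^(d+1)` times a sum `E(a)` whose coefficients are nonzero multiples of
the monomials of degree `2d` with all exponents below `d`. On a line through `a = (1,1,1)` with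
parameter `t`, the base is `x+y+z` plus a multiple of `t`, so its `2d`-th power is divisible by
`t^(d+1)`. As `a₀a₁a₂` is prime to `t`, `E` is divisible by `t^(d+1)`, but its degree is at most
`d`. Hence `E = 0`, and all these monomials lie in the ideal (`prod_pow_eq_zero_of_pow_eq_zero`).

In degree `2d`, the ideal of four forms is the image of a linear map depending linearly on the
forms, so containment is an open condition, given by determinants. The same image is that of the
differential of `(F₁,F₂,G₁,G₂) ↦ F₁G₁ + F₂G₂`. Where it is surjective the map is dominant, and by
Chevalley's theorem its image contains a nonempty open set (`holdsGenerically_exists_apply_self`).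
-/

/-! ### Powers of linear forms and the Cremona substitution -/

/-- A nilpotent perturbed by a multiple of `t`: if `ℓ ^ d = 0` then `(ℓ + t * w) ^ (2 * d)` is
divisible by `t ^ (d + 1)`. -/
theorem pow_succ_dvd_add_mul_pow_two_mul {P : Type*} [CommRing P] {ℓ t w : P} {d : ℕ}
    (h : ℓ ^ d = 0) : t ^ (d + 1) ∣ (ℓ + t * w) ^ (2 * d) := by
  rw [add_pow]
  refine Finset.dvd_sum fun m hm => ?_
  rw [Finset.mem_range] at hm
  rcases le_or_gt d m with hdm | hdm
  · rw [pow_eq_zero_of_le hdm h]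
    simp
  · rw [mul_pow]
    have : t ^ (d + 1) ∣ t ^ (2 * d - m) := pow_dvd_pow _ (by omega)
    exact ((this.mul_right _).mul_left _).mul_right _

/-- The Cremona substitution `x ↦ 1 / x` on a monomial of degree `2 * d`. -/
theorem prod_cremona_pow {P : Type*} [CommRing P] {d : ℕ} (x a : Fin 3 → P)
    (hx : ∀ i, x i ^ d = 0) (k : Fin 3 → ℕ) (hk : ∑ i, k i = 2 * d) :
    ∏ i, (x i * ![a 1 * a 2, a 0 * a 2, a 0 * a 1] i) ^ k i =
      (∏ i, a i) ^ (d + 1) * ∏ i, (x i ^ k i * a i ^ (d - 1 - k i)) := by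
  by_cases h : ∃ i, d ≤ k i
  -- The truncated exponent `d - 1 - k i` is harmless here: both sides contain `x i ^ k i = 0`.
  · obtain ⟨i, hi⟩ := h
    have hi := pow_eq_zero_of_le hi (hx i)
    rw [Finset.prod_eq_zero (Finset.mem_univ i) (by rw [mul_pow, hi, zero_mul]),
      Finset.prod_eq_zero (f := fun i => x i ^ k i * a i ^ (d - 1 - k i)) (Finset.mem_univ i)
        (by rw [hi, zero_mul]), mul_zero]
  · push Not at h
    have h0 := h 0
    have h1 := h 1
    have h2 := h 2
    simp only [Fin.sum_univ_three] at hk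
    simp only [Fin.prod_univ_three, Matrix.cons_val, mul_pow]
    -- The exponent is `k 1 + k 2 = 2d - k 0 = (d + 1) + (d - 1 - k 0)`.
    have q0 : a 0 ^ (k 1) * a 0 ^ (k 2) = a 0 ^ (d + 1) * a 0 ^ (d - 1 - k 0) := by
      rw [← pow_add, ← pow_add]; congr 1; omega
    have q1 : a 1 ^ (k 0) * a 1 ^ (k 2) = a 1 ^ (d + 1) * a 1 ^ (d - 1 - k 1) := by
      rw [← pow_add, ← pow_add]; congr 1; omega
    have q2 : a 2 ^ (k 0) * a 2 ^ (k 1) = a 2 ^ (d + 1) * a 2 ^ (d - 1 - k 2) := by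
      rw [← pow_add, ← pow_add]; congr 1; omega
    calc _ = x 0 ^ k 0 * x 1 ^ k 1 * x 2 ^ k 2 * (a 0 ^ (k 1) * a 0 ^ (k 2)) *
          (a 1 ^ (k 0) * a 1 ^ (k 2)) * (a 2 ^ (k 0) * a 2 ^ (k 1)) := by ring
      _ = _ := by rw [q0, q1, q2]; ring

/-- The multinomial expansion of `(x₀ + x₁ + x₂) ^ (2 * d)` after the Cremona substitution, stripped
of the common factor `(a₀ a₁ a₂) ^ (d + 1)`. -/
noncomputable def cremonaSum {P : Type*} [CommRing P] (d : ℕ) (x a : Fin 3 → P) : P :=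
  ∑ k ∈ Finset.piAntidiag Finset.univ (2 * d),
    (Nat.multinomial Finset.univ k : P) * ∏ i, (x i ^ k i * a i ^ (d - 1 - k i))

theorem sum_cremona_pow {P : Type*} [CommRing P] {d : ℕ} (x a : Fin 3 → P)
    (hx : ∀ i, x i ^ d = 0) :
    (∑ i, x i * ![a 1 * a 2, a 0 * a 2, a 0 * a 1] i) ^ (2 * d) =
      (∏ i, a i) ^ (d + 1) * cremonaSum d x a := by
  rw [Finset.sum_pow_eq_sum_piAntidiag, cremonaSum, Finset.mul_sum]
  refine Finset.sum_congr rfl fun k hk => ?_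
  rw [prod_cremona_pow x a hx k (by simpa using hk)]
  ring

theorem map_cremonaSum {P P' : Type*} [CommRing P] [CommRing P'] (f : P →+* P') (d : ℕ)
    (x a : Fin 3 → P) : f (cremonaSum d x a) = cremonaSum d (fun i => f (x i)) fun i => f (a i) := by
  simp [cremonaSum]

/-- The Cremona sum vanishes identically when `x₀, x₁, x₂` and `x₀ + x₁ + x₂` have vanishing `d`-th
powers: along a line through `(1, 1, 1)` it has degree at most `d` and vanishes to order at least
`d + 1` at that point. -/
theorem cremonaSum_eq_zero {T : Type*} [CommRing T] {d : ℕ} (x a : Fin 3 → T)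
    (hx : ∀ i, x i ^ d = 0) (hs : (∑ i, x i) ^ d = 0) : cremonaSum d x a = 0 := by
  -- The line joining `(1, 1, 1)` at parameter `0` to `a` at parameter `1`.
  let A : Fin 3 → Polynomial T := fun i => 1 + Polynomial.X * Polynomial.C (a i - 1)
  let x' : Fin 3 → Polynomial T := fun i => Polynomial.C (x i)
  have hx' : ∀ i, x' i ^ d = 0 := fun i => by simp [x', ← Polynomial.C_pow, hx]
  have hs' : (∑ i, x' i) ^ d = 0 := by
    simp only [x', ← map_sum, ← Polynomial.C_pow, hs, map_zero]
  have hE := sum_cremona_pow x' A hx'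
  have hdvd : (Polynomial.X : Polynomial T) ^ (d + 1) ∣
      (∑ i, x' i * ![A 1 * A 2, A 0 * A 2, A 0 * A 1] i) ^ (2 * d) := by
    obtain ⟨w, hw⟩ : ∃ w, ∑ i, x' i * ![A 1 * A 2, A 0 * A 2, A 0 * A 1] i =
        ∑ i, x' i + Polynomial.X * w := by
      suffices h : (Polynomial.X : Polynomial T) ∣
          ∑ i, x' i * ![A 1 * A 2, A 0 * A 2, A 0 * A 1] i - ∑ i, x' i by
        obtain ⟨w, hw⟩ := h
        exact ⟨w, by rw [← hw]; ring⟩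
      rw [Polynomial.X_dvd_iff]
      simp [Fin.sum_univ_three, A, x', Polynomial.mul_coeff_zero]
    rw [hw]
    exact pow_succ_dvd_add_mul_pow_two_mul hs'
  have hcop : IsCoprime ((Polynomial.X : Polynomial T) ^ (d + 1)) ((∏ i, A i) ^ (d + 1)) := by
    refine IsCoprime.pow (IsCoprime.prod_right fun i _ => ⟨-Polynomial.C (a i - 1), 1, ?_⟩)
    simp only [A]
    ring
  rw [hE] at hdvd
  have hG := hcop.dvd_of_dvd_mul_left hdvd
  -- Nonzero terms have all `k i < d`, hence degree at most `3(d - 1) - 2d = d - 3`; the bound `d`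
  -- is enough.
  have hdeg : (cremonaSum d x' A).natDegree ≤ d := by
    refine Polynomial.natDegree_sum_le_of_forall_le _ _ fun k hk => ?_
    have hk : ∑ i, k i = 2 * d := by simpa using hk
    by_cases h : ∃ i, d ≤ k i
    · obtain ⟨i, hi⟩ := h
      rw [Finset.prod_eq_zero (Finset.mem_univ i) (by
        rw [pow_eq_zero_of_le hi (hx' i), zero_mul])]
      simp
    · push Not at h
      have hA : ∀ i, (A i).natDegree ≤ 1 := fun i => by
        simp only [A]
        compute_degree
      refine (Polynomial.natDegree_mul_le).trans ?_
      rw [Polynomial.natDegree_natCast, zero_add]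
      refine (Polynomial.natDegree_prod_le _ _).trans ?_
      have : ∀ i, (x' i ^ k i * A i ^ (d - 1 - k i)).natDegree ≤ d - 1 - k i := fun i => by
        rw [← Polynomial.C_pow]
        refine (Polynomial.natDegree_C_mul_le _ _).trans ?_
        simpa using Polynomial.natDegree_pow_le_of_le (d - 1 - k i) (hA i)
      refine (Finset.sum_le_sum fun i _ => this i).trans ?_
      have h0 := h 0
      have h1 := h 1
      have h2 := h 2
      simp only [Fin.sum_univ_three] at hk ⊢
      omega
  have hzero : cremonaSum d x' A = 0 := by
    ext n
    rcases le_or_gt n d with hn | hn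
    · exact (Polynomial.X_pow_dvd_iff.1 hG) n (by omega)
    · exact Polynomial.coeff_eq_zero_of_natDegree_lt (hdeg.trans_lt hn)
  have := congrArg (Polynomial.evalRingHom (1 : T)) hzero
  rw [map_cremonaSum, map_zero] at this
  simpa [A, x'] using this

/-- If `x₀, x₁, x₂` and `x₀ + x₁ + x₂` have vanishing `d`-th powers in a `ℚ`-algebra, then every
monomial of degree `2 * d` in `x₀, x₁, x₂` vanishes. -/
theorem prod_pow_eq_zero_of_pow_eq_zero {R : Type*} [CommRing R] [Algebra ℚ R] {d : ℕ}
    (x : Fin 3 → R) (hx : ∀ i, x i ^ d = 0) (hs : (∑ i, x i) ^ d = 0)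
    (k : Fin 3 → ℕ) (hk : ∑ i, k i = 2 * d) : ∏ i, x i ^ k i = 0 := by
  by_cases h : ∃ i, d ≤ k i
  · obtain ⟨i, hi⟩ := h
    exact Finset.prod_eq_zero (Finset.mem_univ i) (pow_eq_zero_of_le hi (hx i))
  push Not at h
  -- With indeterminates for `a`, each monomial in the `x i` can be read off as a coefficient.
  have hz := cremonaSum_eq_zero (T := MvPolynomial (Fin 3) R) (fun i => C (x i)) X
    (fun i => by rw [← C_pow, hx, C_0]) (by rw [← map_sum, ← C_pow, hs, C_0])
  have hterm : ∀ l : Fin 3 → ℕ, (Nat.multinomial Finset.univ l : MvPolynomial (Fin 3) R) *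
      ∏ i, (C (x i) ^ l i * X i ^ (d - 1 - l i)) =
      monomial (Finsupp.equivFunOnFinite.symm fun i => d - 1 - l i)
        ((Nat.multinomial Finset.univ l : R) * ∏ i, x i ^ l i) := fun l => by
    rw [Finset.prod_mul_distrib, monomial_eq, Finsupp.prod_fintype _ _ (by simp)]
    simp [mul_assoc]
  have hc := congrArg (coeff (Finsupp.equivFunOnFinite.symm fun i => d - 1 - k i)) hz
  simp only [cremonaSum, hterm, coeff_sum, coeff_zero, coeff_monomial] at hc
  rw [Finset.sum_eq_single k] at hc
  · rw [if_pos rfl] at hc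
    have hm : (Nat.multinomial Finset.univ k : ℚ) ≠ 0 := by
      exact_mod_cast (Nat.multinomial_pos _ _).ne'
    have hu : IsUnit (Nat.multinomial Finset.univ k : R) := by
      simpa using (IsUnit.mk0 _ hm).map (algebraMap ℚ R)
    exact (hu.mul_right_eq_zero).1 hc
  · intro l _ hl
    split_ifs with he
    -- Truncated subtraction can make exponents collide only when some `l i ≥ d`, and then the
    -- coefficient is zero.
    · by_cases h' : ∃ i, d ≤ l i
      · obtain ⟨i, hi⟩ := h'
        rw [Finset.prod_eq_zero (f := fun i => x i ^ l i) (Finset.mem_univ i)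
          (pow_eq_zero_of_le hi (hx i)), mul_zero]
      · push Not at h'
        refine absurd (_root_.funext fun i => ?_) hl
        have := congrFun (Finsupp.equivFunOnFinite.symm.injective he) i
        have := h i
        have := h' i
        omega
    · rfl
  · intro hk'
    exact absurd (by simpa using hk) hk'

/-! ### Open conditions and dominant maps -/

/-- Surjectivity is a Zariski open condition on the members of a linear family of linear maps. -/
theorem isZariskiOpen_surjective {V W U : Type*} [AddCommGroup V] [Module ℂ V] [AddCommGroup W]
    [Module ℂ W] [AddCommGroup U] [Module ℂ U] [FiniteDimensional ℂ U]
    (Φ : V →ₗ[ℂ] W →ₗ[ℂ] U) : IsZariskiOpen {v | Function.Surjective (Φ v)} := by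
  let b := Module.finBasis ℂ U
  let M : (U →ₗ[ℂ] W) → Matrix _ _ (MvPolynomial (Module.Dual ℂ V) ℂ) := fun ψ =>
    Matrix.of fun i j => X ((b.coord i).comp (Φ.flip (ψ (b j))))
  have hM : ∀ ψ v, eval (fun φ : Module.Dual ℂ V => φ v) (M ψ).det =
      LinearMap.det ((Φ v).comp ψ) := fun ψ v => by
    rw [RingHom.map_det, ← LinearMap.det_toMatrix b]
    congr 1
    ext i j
    simp [M, LinearMap.toMatrix_apply]
  -- `Φ v` is surjective exactly when some `Φ v ∘ ψ` is invertible: a right inverse `ψ` gives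
  -- determinant `1`.
  refine ⟨Set.range fun ψ => (M ψ).det, Set.ext fun v => ?_⟩
  simp only [Set.mem_ofPred_eq, Set.exists_range_iff, hM]
  constructor
  · intro h
    obtain ⟨ψ, hψ⟩ := (Φ v).exists_rightInverse_of_surjective (LinearMap.range_eq_top.2 h)
    exact ⟨ψ, by simp [hψ]⟩
  · rintro ⟨ψ, hψ⟩
    have h : Function.Surjective ((Φ v).comp ψ) :=
      ((LinearMap.equivOfDetNeZero _ hψ).surjective :)
    exact Function.Surjective.of_comp (g := ψ) h

/-- The image of a dominant polynomial map between affine spaces over an algebraically closed field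
contains a nonempty basic open set. -/
theorem exists_basicOpen_subset_range {K ι κ : Type*} [Field K] [IsAlgClosed K] [Finite ι]
    [Finite κ] (f : MvPolynomial ι K →ₐ[K] MvPolynomial κ K) (hf : Function.Injective f) :
    ∃ u : MvPolynomial ι K, u ≠ 0 ∧
      ∀ x : ι → K, eval x u ≠ 0 → ∃ y : κ → K, ∀ i, eval y (f (X i)) = x i := by
  have hfin : f.toRingHom.FinitePresentation := by
    rw [← RingHom.FinitePresentation.of_finiteType]
    refine RingHom.FiniteType.of_comp_finiteType (f := algebraMap K _) ?_
    rw [AlgHom.toRingHom_eq_coe, AlgHom.comp_algebraMap]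
    exact (RingHom.finiteType_algebraMap).2 inferInstance
  obtain ⟨S, hS⟩ := PrimeSpectrum.exists_constructibleSetData_iff.2
    (PrimeSpectrum.isConstructible_range_comap hfin)
  -- Injectivity puts the generic point in the range. The constructible piece containing it has all
  -- closed equations zero, so it is a basic open set.
  have hbot : (⊥ : PrimeSpectrum (MvPolynomial ι K)) ∈ S.toSet := by
    rw [hS]
    refine ⟨⊥, PrimeSpectrum.ext ?_⟩
    exact (RingHom.injective_iff_ker_eq_bot f.toRingHom).1 hf
  simp only [PrimeSpectrum.ConstructibleSetData.toSet, Set.mem_iUnion] at hbot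
  obtain ⟨D, hD, hg, hu⟩ := hbot
  have hg : ∀ i, D.g i = 0 := fun i => by
    simpa using hg (Set.mem_range_self i)
  refine ⟨D.f, fun h => hu (by simp [h]), fun x hx => ?_⟩
  let m : PrimeSpectrum (MvPolynomial ι K) :=
    ⟨vanishingIdeal K {x}, Ideal.IsMaximal.isPrime inferInstance⟩
  have hm : m ∈ Set.range (PrimeSpectrum.comap f.toRingHom) := by
    rw [← hS]
    refine Set.mem_biUnion hD ⟨?_, fun h => hx ?_⟩
    · rintro _ ⟨i, rfl⟩
      simp [hg]
    · simpa [m, aeval_eq_eval] using h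
  obtain ⟨q, hq⟩ := hm
  -- The prime `q` above `x` need not be maximal. Any maximal ideal containing it still contains
  -- each `f (X i) - x i`, and by the Nullstellensatz it is a point `y`.
  obtain ⟨M, hM, hqM⟩ := Ideal.exists_le_maximal q.asIdeal q.2.ne_top
  obtain ⟨y, rfl⟩ := isMaximal_iff_eq_vanishingIdeal_singleton.1 hM
  refine ⟨y, fun i => ?_⟩
  have : X i - C (x i) ∈ m.asIdeal := by simp [m]
  rw [← hq] at this
  have := hqM this
  simpa [sub_eq_zero, aeval_eq_eval, ← algebraMap_eq] using this

theorem MvPolynomial.map_aeval_eq_eval {K ι P : Type*} [CommSemiring K] [CommSemiring P]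
    [Algebra K P] (φ : P →+* K) (hφ : ∀ r, φ (algebraMap K P r) = r) (g : ι → P)
    (p : MvPolynomial ι K) : φ (aeval g p) = eval (fun i => φ (g i)) p := by
  rw [map_aeval, show φ.comp (algebraMap K P) = RingHom.id K from RingHom.ext hφ]
  rfl

theorem MvPolynomial.aeval_mul_of_isHomogeneous {K ι P : Type*} [CommSemiring K] [CommSemiring P]
    [Algebra K P] {p : MvPolynomial ι K} {n : ℕ} (hp : p.IsHomogeneous n) (t : P) (w : ι → P) :
    aeval (fun i => t * w i) p = t ^ n * aeval w p := by
  rw [aeval_def, aeval_def, eval₂_eq, eval₂_eq, Finset.mul_sum]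
  refine Finset.sum_congr rfl fun m hm => ?_
  have hdeg : ∑ i ∈ m.support, m i = n := hp.degree_eq_sum_deg_support hm ▸ rfl
  simp only [mul_pow, Finset.prod_mul_distrib, Finset.prod_pow_eq_pow_sum, hdeg]
  ring

/-- A polynomial that vanishes on arcs through the origin in every direction is zero. -/
theorem MvPolynomial.eq_zero_of_eval_arc {K ι : Type*} [Field K] [Infinite K]
    (p : MvPolynomial ι K)
    (h : ∀ y : ι → K, ∃ z : ι → K, ∀ t : K, eval (fun i => t * y i + t ^ 2 * z i) p = 0) :
    p = 0 := by
  suffices hk : ∀ k, homogeneousComponent k p = 0 by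
    rw [← sum_homogeneousComponent p]
    simp [hk]
  intro k
  induction k using Nat.strong_induction_on with
  | _ k ih =>
    refine (homogeneousComponent_isHomogeneous k p).eq_zero_of_forall_eval_eq_zero fun y => ?_
    obtain ⟨z, hz⟩ := h y
    let w : ι → Polynomial K := fun i => Polynomial.C (y i) + Polynomial.X * Polynomial.C (z i)
    have hp : aeval (fun i => Polynomial.X * w i) p = 0 := by
      refine Polynomial.funext fun t => ?_
      rw [Polynomial.eval_zero, ← hz t, ← Polynomial.coe_evalRingHom,
        map_aeval_eq_eval _ (by simp)]
      congr 2
      ext i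
      simp [w]
      ring
    -- The arc is `t (y + t z)`, so the degree `j` component contributes a multiple of `t ^ j`.
    -- Components below `k` vanish by induction, and the total is zero.
    have hdvd : Polynomial.X ^ (k + 1) ∣
        aeval (fun i => Polynomial.X * w i) (homogeneousComponent k p) := by
      have hsum : aeval (fun i => Polynomial.X * w i) p = ∑ j ∈ Finset.range (p.totalDegree + 1),
          aeval (fun i => Polynomial.X * w i) (homogeneousComponent j p) := by
        rw [← map_sum, sum_homogeneousComponent]
      rw [hp] at hsum
      by_cases hkm : k ∈ Finset.range (p.totalDegree + 1)
      · rw [← Finset.add_sum_erase _ _ hkm] at hsum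
        rw [eq_neg_of_add_eq_zero_left hsum.symm, dvd_neg]
        refine Finset.dvd_sum fun j hj => ?_
        rcases lt_or_gt_of_ne (Finset.ne_of_mem_erase hj) with hjk | hjk
        · simp [ih j hjk]
        · rw [aeval_mul_of_isHomogeneous (homogeneousComponent_isHomogeneous j p)]
          exact (pow_dvd_pow _ hjk).mul_right _
      · rw [homogeneousComponent_eq_zero _ _ (by simpa using hkm), map_zero]
        exact dvd_zero _
    rw [aeval_mul_of_isHomogeneous (homogeneousComponent_isHomogeneous k p), pow_succ] at hdvd
    have hX := (mul_dvd_mul_iff_left (pow_ne_zero k Polynomial.X_ne_zero)).1 hdvd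
    rw [Polynomial.X_dvd_iff, Polynomial.coeff_zero_eq_eval_zero, ← Polynomial.coe_evalRingHom,
      map_aeval_eq_eval _ (by simp)] at hX
    simpa [w] using hX

/-- A quadratic map whose differential is surjective at some point hits a general vector. -/
theorem holdsGenerically_exists_apply_self {V U : Type*} [AddCommGroup V] [Module ℂ V]
    [FiniteDimensional ℂ V] [AddCommGroup U] [Module ℂ U] [FiniteDimensional ℂ U]
    (B : V →ₗ[ℂ] V →ₗ[ℂ] U) (v₀ : V) (h : Function.Surjective fun v => B v₀ v + B v v₀) :
    HoldsGenerically fun u => ∃ v, B v v = u := by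
  let b := Module.finBasis ℂ U
  let c := Module.finBasis ℂ V
  let g : _ → MvPolynomial _ ℂ := fun i =>
    ∑ k, ∑ l, C (b.repr (B (c k) (c l)) i) * (X k * X l)
  have hg : ∀ y i, eval y (g i) = b.repr (B (∑ k, y k • c k) (∑ k, y k • c k)) i := fun y i => by
    simp only [g, map_sum, map_mul, eval_C, eval_X, map_smul, LinearMap.sum_apply,
      LinearMap.smul_apply, Finsupp.coe_finsetSum, Finset.sum_apply, Finsupp.smul_apply,
      smul_eq_mul, Finset.mul_sum]
    rw [Finset.sum_comm]
    exact Finset.sum_congr rfl fun _ _ => Finset.sum_congr rfl fun _ _ => by ring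
  have hg' : ∀ v i, eval (c.repr v) (g i) = b.repr (B v v) i := fun v i => by
    rw [hg, c.sum_repr]
  -- Dominance: no nonzero `p` vanishes on the whole image.
  have hinj : Function.Injective (aeval g : MvPolynomial _ ℂ →ₐ[ℂ] _) := by
    rw [injective_iff_map_eq_zero]
    intro p hp
    have hv : ∀ v, eval (b.repr (B v v)) p = 0 := fun v => by
      have := congrArg (eval (c.repr v)) hp
      rw [map_aeval_eq_eval _ (by simp), map_zero] at this
      simpa only [hg'] using this
    let u₀ := b.repr (B v₀ v₀)
    have ht : ∀ x : _ → ℂ, eval x (aeval (fun i => X i + C (u₀ i)) p) =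
        eval (fun i => x i + u₀ i) p := fun x => by
      rw [map_aeval_eq_eval _ (by simp)]
      simp
    have hp' : aeval (fun i => X i + C (u₀ i)) p = (0 : MvPolynomial _ ℂ) := by
      -- Expanding `B` at `v₀ + t v` gives `B v₀ v₀ + t y + t² B v v`; surjectivity of the
      -- differential makes every direction `y` occur.
      refine eq_zero_of_eval_arc _ fun y => ?_
      obtain ⟨v, hv'⟩ := h (∑ i, y i • b i)
      beta_reduce at hv'
      refine ⟨b.repr (B v v), fun t => ?_⟩
      rw [ht, ← hv (v₀ + t • v)]
      congr 2
      ext i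
      have hy : y i = b.repr (B v₀ v) i + b.repr (B v v₀) i := by
        rw [← Finsupp.add_apply, ← map_add, hv', b.repr_sum_self]
      simp [hy, u₀]
      ring
    refine MvPolynomial.funext fun x => ?_
    have := ht fun i => x i - u₀ i
    rw [hp', map_zero] at this
    simpa using this.symm
  obtain ⟨u, hu, hrange⟩ := exists_basicOpen_subset_range (aeval g) hinj
  have hev : ∀ w, eval (fun φ : Module.Dual ℂ U => φ w) (rename b.coord u) =
      eval (b.repr w) u := fun w => by
    rw [eval_rename]
    rfl
  refine ⟨_, ⟨{rename b.coord u}, rfl⟩, ?_, ?_⟩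
  · obtain ⟨x, hx⟩ : ∃ x, eval x u ≠ 0 := by
      by_contra! hne
      exact hu (MvPolynomial.funext fun x => by simp [hne x])
    refine ⟨∑ i, x i • b i, _, rfl, ?_⟩
    rw [hev, b.repr_sum_self]
    exact hx
  · rintro w ⟨_, rfl, hw⟩
    rw [hev] at hw
    obtain ⟨y, hy⟩ := hrange _ hw
    refine ⟨∑ k, y k • c k, b.repr.injective (Finsupp.ext fun i => ?_)⟩
    rw [← hg, ← hy i, aeval_X]

/-! ### Products of forms and ideals in degree `2d` -/

instance ternaryForm_finite (n : ℕ) : Module.Finite ℂ (TernaryForm n) :=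
  Module.Finite.iff_fg.2 (homogeneousSubmodule_fg (Fin 3) ℂ n)

/-- The product of two forms of degree `d`, as a bilinear map. -/
noncomputable def formMul (d : ℕ) :
    TernaryForm d →ₗ[ℂ] TernaryForm d →ₗ[ℂ] TernaryForm (2 * d) :=
  LinearMap.mk₂ ℂ (fun F G => ⟨F * G, two_mul d ▸ IsHomogeneous.mul F.2 G.2⟩)
    (fun _ _ _ => Subtype.ext (add_mul _ _ _)) (fun _ _ _ => Subtype.ext (smul_mul_assoc _ _ _))
    (fun _ _ _ => Subtype.ext (mul_add _ _ _)) (fun _ _ _ => Subtype.ext (mul_smul_comm _ _ _))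

@[simp]
theorem coe_formMul {d : ℕ} (F G : TernaryForm d) :
    (formMul d F G : MvPolynomial (Fin 3) ℂ) = F * G := rfl

/-- The pairing `(Q, H) ↦ ∑ Qᵢ Hᵢ` of quadruples of forms of degree `d`. -/
noncomputable def quadruplePairing (d : ℕ) :
    (Fin 4 → TernaryForm d) →ₗ[ℂ] (Fin 4 → TernaryForm d) →ₗ[ℂ] TernaryForm (2 * d) :=
  ∑ i, (formMul d).compl₁₂ (LinearMap.proj i) (LinearMap.proj i)

theorem quadruplePairing_apply {d : ℕ} (Q H : Fin 4 → TernaryForm d) :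
    quadruplePairing d Q H = ∑ i, formMul d (Q i) (H i) := by
  simp [quadruplePairing]

/-- The quadratic map `(F₁, F₂, G₁, G₂) ↦ F₁ G₁ + F₂ G₂`, in polarized form. -/
noncomputable def sumOfProducts (d : ℕ) :
    (Fin 4 → TernaryForm d) →ₗ[ℂ] (Fin 4 → TernaryForm d) →ₗ[ℂ] TernaryForm (2 * d) :=
  (formMul d).compl₁₂ (LinearMap.proj 0) (LinearMap.proj 2) +
    (formMul d).compl₁₂ (LinearMap.proj 1) (LinearMap.proj 3)

theorem sumOfProducts_apply {d : ℕ} (Q H : Fin 4 → TernaryForm d) :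
    sumOfProducts d Q H = formMul d (Q 0) (H 2) + formMul d (Q 1) (H 3) := by
  simp [sumOfProducts]

theorem homogeneousComponent_mul_of_isHomogeneous {σ R : Type*} [CommSemiring R] {m n : ℕ}
    {q : MvPolynomial σ R} (hq : q.IsHomogeneous n) (p : MvPolynomial σ R) :
    homogeneousComponent (m + n) (p * q) = homogeneousComponent m p * q := by
  conv_lhs => rw [← sum_homogeneousComponent p, Finset.sum_mul, map_sum]
  have h : ∀ j, homogeneousComponent (m + n) (homogeneousComponent j p * q) =
      if j = m then homogeneousComponent j p * q else 0 := fun j => by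
    rw [homogeneousComponent_of_mem ((homogeneousComponent_isHomogeneous j p).mul hq)]
    simp [eq_comm]
  simp only [h, Finset.sum_ite_eq', Finset.mem_range]
  split_ifs with hm
  · rfl
  · rw [homogeneousComponent_eq_zero _ _ (by omega), zero_mul]

theorem idealOfFour_eq_span_range {d : ℕ} (Q : Fin 4 → TernaryForm d) :
    idealOfFour (Q 0) (Q 1) (Q 2) (Q 3) =
      Ideal.span (Set.range fun i => (Q i : MvPolynomial (Fin 3) ℂ)) := by
  rw [idealOfFour]
  congr 1
  ext p
  simp [Fin.exists_fin_succ, eq_comm]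

/-- The ideal generated by four forms of degree `d` contains all forms of degree `2 * d` if and only
if each of these is a combination of the four with coefficients of degree `d`. -/
theorem containsAllForms_iff_surjective {d : ℕ} (Q : Fin 4 → TernaryForm d) :
    ContainsAllForms (idealOfFour (Q 0) (Q 1) (Q 2) (Q 3)) (2 * d) ↔
      Function.Surjective (quadruplePairing d Q) := by
  rw [idealOfFour_eq_span_range]
  constructor
  · rintro h ⟨p, hp⟩
    obtain ⟨a, ha⟩ := Ideal.mem_span_range_iff_exists_fun.1 (h p hp)
    -- The coefficients `a i` are arbitrary polynomials; only their degree `d` parts contribute in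
    -- degree `2d`.
    refine ⟨fun i => ⟨homogeneousComponent d (a i), homogeneousComponent_mem _ _⟩,
      Subtype.ext ?_⟩
    rw [quadruplePairing_apply, AddSubmonoidClass.coe_finsetSum]
    have := congrArg (homogeneousComponent (2 * d)) ha
    rw [homogeneousComponent_eq_self hp, map_sum] at this
    refine (Finset.sum_congr rfl fun i _ => ?_).trans this
    rw [coe_formMul, two_mul, homogeneousComponent_mul_of_isHomogeneous (Q i).2, mul_comm]
  · intro h p hp
    obtain ⟨H, hH⟩ := h ⟨p, hp⟩
    rw [Ideal.mem_span_range_iff_exists_fun]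
    refine ⟨fun i => H i, ?_⟩
    have := congrArg Subtype.val hH
    rw [quadruplePairing_apply, AddSubmonoidClass.coe_finsetSum] at this
    exact (Finset.sum_congr rfl fun i _ => mul_comm _ _).trans this

/-- The ideal `(x ^ d, y ^ d, z ^ d, (x + y + z) ^ d)` contains all forms of degree `2 * d`. -/
theorem exists_containsAllForms (d : ℕ) :
    ∃ Q : Fin 4 → TernaryForm d,
      ContainsAllForms (idealOfFour (Q 0) (Q 1) (Q 2) (Q 3)) (2 * d) := by
  let P (i : Fin 3) : TernaryForm d := ⟨X i ^ d, isHomogeneous_X_pow i d⟩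
  let L : TernaryForm d := ⟨(∑ i, X i) ^ d, by
    simpa using (IsHomogeneous.sum Finset.univ (fun i : Fin 3 => (X i : MvPolynomial (Fin 3) ℂ)) 1
      fun i _ => isHomogeneous_X ℂ i).pow d⟩
  refine ⟨![P 0, P 1, P 2, L], fun p hp => ?_⟩
  set I := idealOfFour (![P 0, P 1, P 2, L] 0) (![P 0, P 1, P 2, L] 1) (![P 0, P 1, P 2, L] 2)
    (![P 0, P 1, P 2, L] 3)
  have hX : ∀ i : Fin 3, (X i : MvPolynomial (Fin 3) ℂ) ^ d ∈ I := fun i => by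
    refine Ideal.subset_span ?_
    fin_cases i <;> simp [P]
  have hL : (∑ i : Fin 3, (X i : MvPolynomial (Fin 3) ℂ)) ^ d ∈ I :=
    Ideal.subset_span (by simp [L])
  rw [p.as_sum]
  refine Ideal.sum_mem _ fun m hm => ?_
  rw [monomial_eq, Finsupp.prod_fintype _ _ (by simp)]
  refine Ideal.mul_mem_left _ _ ?_
  rw [← Ideal.Quotient.eq_zero_iff_mem, map_prod]
  simp only [map_pow]
  let _ : Algebra ℚ (MvPolynomial (Fin 3) ℂ ⧸ I) :=
    ((algebraMap ℂ (MvPolynomial (Fin 3) ℂ ⧸ I)).comp (algebraMap ℚ ℂ)).toAlgebra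
  refine prod_pow_eq_zero_of_pow_eq_zero (d := d) (fun i => Ideal.Quotient.mk I (X i))
    (fun i => ?_) ?_ m ?_
  · rw [← map_pow, Ideal.Quotient.eq_zero_iff_mem]
    exact hX i
  · rw [← map_sum, ← map_pow, Ideal.Quotient.eq_zero_iff_mem]
    exact hL
  · rw [← Finsupp.degree_eq_sum, Finsupp.degree_eq_weight_one]
    exact hp (mem_support_iff.1 hm)

/-- Modulo `F₁, F₂, G₂`, only the `G₁` term of a combination of the four forms survives. -/
theorem containsAllForms_iff_quotientMul_surjective {d : ℕ} (F₁ F₂ G₁ G₂ : TernaryForm d) :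
    ContainsAllForms (idealOfFour F₁ F₂ G₁ G₂) (2 * d) ↔
      Function.Surjective (quotientMul (idealOfThree F₁ F₂ G₂) G₁) := by
  constructor
  · intro h
    have h := (containsAllForms_iff_surjective ![F₁, F₂, G₁, G₂]).1 h
    rintro ⟨_, p, hp, rfl⟩
    obtain ⟨H, hH⟩ := h ⟨p, hp⟩
    have hH := congrArg Subtype.val hH
    simp only [quadruplePairing_apply, Fin.sum_univ_four, Submodule.coe_add, coe_formMul,
      Matrix.cons_val] at hH
    refine ⟨⟨_, H 2, (H 2).2, rfl⟩, Subtype.ext ?_⟩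
    change Ideal.Quotient.mk _ (G₁ : MvPolynomial (Fin 3) ℂ) * Ideal.Quotient.mk _ (H 2).1 =
      Ideal.Quotient.mk _ p
    rw [← map_mul, eq_comm, Ideal.Quotient.eq, ← hH]
    have h₁ : (F₁ : MvPolynomial (Fin 3) ℂ) ∈ idealOfThree F₁ F₂ G₂ :=
      Ideal.subset_span (by simp)
    have h₂ : (F₂ : MvPolynomial (Fin 3) ℂ) ∈ idealOfThree F₁ F₂ G₂ :=
      Ideal.subset_span (by simp)
    have h₃ : (G₂ : MvPolynomial (Fin 3) ℂ) ∈ idealOfThree F₁ F₂ G₂ :=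
      Ideal.subset_span (by simp)
    convert! add_mem (add_mem (Ideal.mul_mem_right (H 0).1 _ h₁)
      (Ideal.mul_mem_right (H 1).1 _ h₂)) (Ideal.mul_mem_right (H 3).1 _ h₃) using 1
    ring
  · intro h p hp
    obtain ⟨⟨_, q, hq, rfl⟩, hqp⟩ := h ⟨_, p, hp, rfl⟩
    have hqp : Ideal.Quotient.mk (idealOfThree F₁ F₂ G₂) (G₁ : MvPolynomial (Fin 3) ℂ) *
        Ideal.Quotient.mk _ q = Ideal.Quotient.mk _ p := congrArg Subtype.val hqp
    rw [← map_mul, eq_comm, Ideal.Quotient.eq] at hqp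
    have hle : idealOfThree F₁ F₂ G₂ ≤ idealOfFour F₁ F₂ G₁ G₂ :=
      Ideal.span_mono (by intro; simp; tauto)
    have hG : (G₁ : MvPolynomial (Fin 3) ℂ) ∈ idealOfFour F₁ F₂ G₁ G₂ :=
      Ideal.subset_span (by simp)
    simpa using add_mem (hle hqp) (Ideal.mul_mem_right q _ hG)

theorem isZariskiOpen_containsAllForms (d : ℕ) :
    IsZariskiOpen {Q : Fin 4 → TernaryForm d |
      ContainsAllForms (idealOfFour (Q 0) (Q 1) (Q 2) (Q 3)) (2 * d)} := by
  simp only [containsAllForms_iff_surjective]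
  exact isZariskiOpen_surjective (quadruplePairing d)

theorem holdsGenerically_containsAllForms (d : ℕ) :
    HoldsGenerically fun Q : Fin 4 → TernaryForm d =>
      ContainsAllForms (idealOfFour (Q 0) (Q 1) (Q 2) (Q 3)) (2 * d) :=
  ⟨_, isZariskiOpen_containsAllForms d, exists_containsAllForms d, fun _ h => h⟩

theorem holdsGenerically_eq_sum_of_products (d : ℕ) :
    HoldsGenerically fun F : TernaryForm (2 * d) =>
      ∃ F₁ F₂ G₁ G₂ : TernaryForm d,
        (F : MvPolynomial (Fin 3) ℂ) =
          (F₁ : MvPolynomial (Fin 3) ℂ) * G₁ + (F₂ : MvPolynomial (Fin 3) ℂ) * G₂ := by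
  obtain ⟨Q, hQ⟩ := exists_containsAllForms d
  rw [containsAllForms_iff_surjective] at hQ
  obtain ⟨U, hU, hne, h⟩ := holdsGenerically_exists_apply_self (sumOfProducts d) Q fun p => by
    obtain ⟨H, rfl⟩ := hQ p
    -- The differential pairs each `Fᵢ` with the variation of `Gᵢ` and conversely, so the two halves
    -- of `H` are exchanged.
    refine ⟨![H 2, H 3, H 0, H 1], Subtype.ext ?_⟩
    simp only [sumOfProducts_apply, quadruplePairing_apply, Fin.sum_univ_four, Submodule.coe_add,
      coe_formMul, Matrix.cons_val]
    ring
  refine ⟨U, hU, hne, fun F hF => ?_⟩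
  obtain ⟨v, rfl⟩ := h F hF
  exact ⟨v 0, v 1, v 2, v 3, by simp [sumOfProducts_apply]⟩

/-- In the generic statements a quadruple `(F₁, F₂, G₁, G₂)` is a function
`Q : Fin 4 → TernaryForm d` with `Q 0 = F₁`, `Q 1 = F₂`, `Q 2 = G₁`, `Q 3 = G₂`. -/
theorem corollary3p9 (d : ℕ) (hd : 0 < d) :
    -- existence
    (∃ F₁ F₂ G₁ G₂ : TernaryForm d, ContainsAllForms (idealOfFour F₁ F₂ G₁ G₂) (2 * d)) ∧
    -- the condition is open, and it holds for a general quadruple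
    IsZariskiOpen {Q : Fin 4 → TernaryForm d |
      ContainsAllForms (idealOfFour (Q 0) (Q 1) (Q 2) (Q 3)) (2 * d)} ∧
    HoldsGenerically (fun Q : Fin 4 → TernaryForm d =>
      ContainsAllForms (idealOfFour (Q 0) (Q 1) (Q 2) (Q 3)) (2 * d)) ∧
    -- the equivalence with surjectivity of the multiplication map
    (∀ F₁ F₂ G₁ G₂ : TernaryForm d,
      ContainsAllForms (idealOfFour F₁ F₂ G₁ G₂) (2 * d) ↔
        Function.Surjective (quotientMul (idealOfThree F₁ F₂ G₂) G₁)) ∧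
    -- the multiplication map is surjective for a general quadruple
    HoldsGenerically (fun Q : Fin 4 → TernaryForm d =>
      Function.Surjective (quotientMul (idealOfThree (Q 0) (Q 1) (Q 3)) (Q 2))) ∧
    -- a generic form of degree `2d` is `F₁ G₁ + F₂ G₂`
    HoldsGenerically (fun F : TernaryForm (2 * d) =>
      ∃ F₁ F₂ G₁ G₂ : TernaryForm d,
        (F : MvPolynomial (Fin 3) ℂ) =
          (F₁ : MvPolynomial (Fin 3) ℂ) * G₁ + (F₂ : MvPolynomial (Fin 3) ℂ) * G₂) := by
  obtain ⟨Q, hQ⟩ := exists_containsAllForms d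
  refine ⟨⟨_, _, _, _, hQ⟩, isZariskiOpen_containsAllForms d, holdsGenerically_containsAllForms d,
    containsAllForms_iff_quotientMul_surjective, ?_, holdsGenerically_eq_sum_of_products d⟩
  obtain ⟨U, hU, hne, h⟩ := holdsGenerically_containsAllForms d
  exact ⟨U, hU, hne, fun Q hQ => (containsAllForms_iff_quotientMul_surjective _ _ _ _).1 (h Q hQ)⟩
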